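/- Let $k\le n$ be natural numbers, put $d=n-k+1$ and assume $2d\le n$. Put $w=(1,k-1,k-1)$, let $\deg_w(X^aY^bZ^c)=a+(k-1)(b+c)$, and let $\prec_w$ be the monomial ordering that compares first $\deg_w$, then the exponent of $X$, then the exponent of $Y$. Let $$t_0=\Bigl\lceil \tfrac12\bigl(n-n\sqrt{1-2d/n}\,\bigr)-1\Bigr\rceil .$$ Setting. Let $F$ be a finite field of characteristic $2$, let $\alpha_1,\dots,\alpha_n\in F$ be distinct and $\beta_1,\dots,\beta_n\in F\setminus\{0\}$. Let $\mathcal A$ be the binary alternant code, i.e. the set of all $c\in\mathbb F_2^n$ of the form $c=(\beta_1f(\alpha_1),\dots,\beta_nf(\alpha_n))$ with $f\in F[X]$, $\deg f<k$, and let $\mathcal{IA}$ be the $2$-interleaved code of all $2\times n$ binary matrices both of whose rows lie in $\mathcal A$. For integers $0\le m_2<m_1$ and a received word $R=\binom{y}{z}\in\mathbb F_2^{2\times n}$, the decoder works as follows. Interpolation. Let $I_R\subseteq F[X,Y,Z]$ be the ideal of all polynomials that, for every $s$, vanish at $(\alpha_s,\beta_s^{-1}y_s,\beta_s^{-1}z_s)$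 with multiplicity $m_1$ and at $(\alpha_s,\beta_s^{-1}\gamma_1,\beta_s^{-1}\gamma_2)$ with multiplicity $m_2$ for each of the three pairs $(\gamma_1,\gamma_2)\in\mathbb F_2^2\setminus\{(y_s,z_s)\}$; here multiplicity $m$ at a point means that all Hasse derivatives of order $(a,b,c)$ with $a+b+c<m$ vanish there. Take a Gröbner basis $G_1,\dots,G_l$ of $I_R$ with respect to $\prec_w$, listed in ascending order of $\deg_w$. Recovery. Let $i\ge 2$ be the least index such that $\gcd(G_1,\dots,G_i)$ involves neither $Y$ nor $Z$. If there is no such $i$, the decoder returns a decoding failure. Otherwise put $\widehat\Delta=\deg_w G_i$; the achieved decoding radius is $$\hat\tau=\frac{n-\widehat\Delta/m_1}{1-m_2/m_1}.$$ Theorem. For all sufficiently large $m_1>m_2$ whose ratio $m_2/m_1$ is sufficiently close to $t_0/(n-t_0)$ (that is, there are $\varepsilon>0$ and $M$, depending only on $n$ and $k$, such that $m_1>m_2\ge M$ and $\bigl|m_2/m_1-t_0/(n-t_0)\bigr|<\varepsilon$ suffice), the following holds for every $F$, $\alpha$, $\beta$ as above, every choice of the Gröbner bases, and every $C\in\mathcal{IA}$: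 for every error matrix $E\in\mathbb F_2^{2\times n}$ the decoder does not fail on $R=C+E$ and its achieved radius satisfies $$\hat\tau>\Bigl\lceil \tfrac12\bigl(n-n\sqrt{1-2d/n}\,\bigr)-1\Bigr\rceil ;$$ in particular, for every probability distribution of $E$, $\Pr\{\text{decoding failure}\}=0$. -/

import Mathlib

open MvPolynomial

namespace InterleavedAlternant

/-! ### Weights and the monomial ordering

Trivariate polynomials live in `MvPolynomial (Fin 3) F`; the variables `X, Y, Z` have the
indices `0, 1, 2`. -/

/-- The weight vector `(1, k - 1, k - 1)`. -/
def weights (k : ℕ) : Fin 3 → ℕ := ![1, k - 1, k - 1]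

/-- The weighted degree of the monomial `X^(a 0) Y^(a 1) Z^(a 2)`. -/
def monomialWeight (w : Fin 3 → ℕ) (a : Fin 3 →₀ ℕ) : ℕ :=
  w 0 * a 0 + w 1 * a 1 + w 2 * a 2

/-- Exponent vectors, carrying the ordering `≺_w`. -/
def WeightedExponent (_w : Fin 3 → ℕ) : Type := Fin 3 →₀ ℕ

noncomputable instance (w : Fin 3 → ℕ) : AddCommMonoid (WeightedExponent w) :=
  inferInstanceAs (AddCommMonoid (Fin 3 →₀ ℕ))

/-- The comparison key of `≺_w`: first the weighted degree, then the exponent of `X`, then the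
exponent of `Y`. The exponent of `Z` comes last; it is determined by the other entries as soon as
the weight of `Z` is positive, so it only makes the ordering total for degenerate weights. -/
def orderKey (w : Fin 3 → ℕ) (a : Fin 3 →₀ ℕ) : ℕ ×ₗ ℕ ×ₗ ℕ ×ₗ ℕ :=
  toLex (monomialWeight w a, toLex (a 0, toLex (a 1, a 2)))

theorem orderKey_injective (w : Fin 3 → ℕ) : Function.Injective (orderKey w) := by
  intro a b h
  have h' := toLex.injective h
  simp only [Prod.mk.injEq, EmbeddingLike.apply_eq_iff_eq] at h'
  refine Finsupp.ext (fun i => ?_)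
  fin_cases i
  · exact h'.2.1
  · exact h'.2.2.1
  · exact h'.2.2.2

theorem orderKey_add (w : Fin 3 → ℕ) (a b : Fin 3 →₀ ℕ) :
    orderKey w (a + b) = orderKey w a + orderKey w b := by
  have h : monomialWeight w (a + b) = monomialWeight w a + monomialWeight w b := by
    simp only [monomialWeight, Finsupp.add_apply]
    ring
  unfold orderKey
  rw [h]
  rfl

noncomputable instance (w : Fin 3 → ℕ) : LinearOrder (WeightedExponent w) :=
  LinearOrder.lift' (orderKey w) (orderKey_injective w)

theorem weightedExponent_le_iff (w : Fin 3 → ℕ) (a b : WeightedExponent w) :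
    a ≤ b ↔ orderKey w a ≤ orderKey w b := Iff.rfl

instance (w : Fin 3 → ℕ) : IsOrderedAddMonoid (WeightedExponent w) where
  add_le_add_left a b h c := by
    rw [weightedExponent_le_iff] at h ⊢
    exact (orderKey_add w a c).trans_le
      ((add_le_add_left h _).trans_eq (orderKey_add w b c).symm)

instance (w : Fin 3 → ℕ) : WellFoundedLT (WeightedExponent w) :=
  ⟨InvImage.wf (orderKey w) wellFounded_lt⟩

/-- The monomial ordering `≺_w`. -/
noncomputable def weightedOrder (w : Fin 3 → ℕ) : MonomialOrder (Fin 3) where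
  syn := WeightedExponent w
  toSyn := AddEquiv.refl _
  toSyn_monotone a b h := by
    change orderKey w a ≤ orderKey w b
    have h0 := h 0
    have h1 := h 1
    have h2 := h 2
    have hw : monomialWeight w a ≤ monomialWeight w b := by
      unfold monomialWeight
      gcongr
    exact Prod.Lex.toLex_mono ⟨hw, Prod.Lex.toLex_mono ⟨h0, Prod.Lex.toLex_mono ⟨h1, h2⟩⟩⟩

/-- `≺_w` spelled out, for positive weights. -/
theorem weightedOrder_lt_iff (w : Fin 3 → ℕ) (hw : 0 < w 2) (a b : Fin 3 →₀ ℕ) :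
    (weightedOrder w).toSyn a < (weightedOrder w).toSyn b ↔
      monomialWeight w a < monomialWeight w b ∨
        (monomialWeight w a = monomialWeight w b ∧ (a 0 < b 0 ∨ (a 0 = b 0 ∧ a 1 < b 1))) := by
  change orderKey w a < orderKey w b ↔ _
  unfold orderKey
  simp only [Prod.Lex.toLex_lt_toLex]
  constructor
  · rintro (h | ⟨h, h' | ⟨h', h'' | ⟨h'', h3⟩⟩⟩)
    · exact Or.inl h
    · exact Or.inr ⟨h, Or.inl h'⟩
    · exact Or.inr ⟨h, Or.inr ⟨h', h''⟩⟩
    · exfalso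
      change a 0 = b 0 at h'
      change a 1 = b 1 at h''
      change a 2 < b 2 at h3
      unfold monomialWeight at h
      rw [h', h''] at h
      have := Nat.mul_lt_mul_of_pos_left h3 hw
      omega
  · rintro (h | ⟨h, h' | ⟨h', h''⟩⟩)
    · exact Or.inl h
    · exact Or.inr ⟨h, Or.inl h'⟩
    · exact Or.inr ⟨h, Or.inr ⟨h', Or.inl h''⟩⟩

/-- `G` is a Gröbner basis of the ideal `I` for the monomial ordering `m`: a finite family of
nonzero elements of `I` such that the leading monomial of every nonzero element of `I` is
divisible by the leading monomial of a member of the family. -/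
def IsGroebnerBasis {F : Type*} [Field F] (m : MonomialOrder (Fin 3))
    (I : Ideal (MvPolynomial (Fin 3) F)) (G : List (MvPolynomial (Fin 3) F)) : Prop :=
  (∀ g ∈ G, g ∈ I ∧ g ≠ 0) ∧ ∀ f ∈ I, f ≠ 0 → ∃ g ∈ G, m.degree g ≤ m.degree f

/-! ### Hasse derivatives and multiplicities -/

/-- The `(a 0, a 1, a 2)`-th Hasse derivative. (The binomial product vanishes unless `a ≤ p`, so
the truncated subtraction `p - a` is harmless.) -/
noncomputable def hasseDeriv {F : Type*} [Field F] (a : Fin 3 →₀ ℕ)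
    (G : MvPolynomial (Fin 3) F) : MvPolynomial (Fin 3) F :=
  ∑ p ∈ G.support, monomial (p - a) ((∏ i, ((p i).choose (a i) : F)) * coeff p G)

/-- `G` passes through the point `P` with multiplicity `m`. -/
def HasMultiplicity {F : Type*} [Field F] (m : ℕ) (G : MvPolynomial (Fin 3) F)
    (P : Fin 3 → F) : Prop :=
  ∀ a : Fin 3 →₀ ℕ, a 0 + a 1 + a 2 < m → eval P (hasseDeriv a G) = 0

theorem eval_hasseDeriv {F : Type*} [Field F] (P : Fin 3 → F) (a : Fin 3 →₀ ℕ)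
    (G : MvPolynomial (Fin 3) F) (S : Finset (Fin 3 →₀ ℕ)) (hS : G.support ⊆ S) :
    eval P (hasseDeriv a G) =
      ∑ p ∈ S, (∏ i, ((p i).choose (a i) * P i ^ (p i - a i))) * coeff p G := by
  rw [hasseDeriv, map_sum, ← Finset.sum_subset hS]
  · refine Finset.sum_congr rfl fun p _ => ?_
    rw [eval_monomial, Finsupp.prod_fintype _ _ (by simp), Finset.prod_mul_distrib]
    simp only [Finsupp.tsub_apply]
    ring
  · intro p _ hp
    rw [notMem_support_iff.mp hp, mul_zero]

theorem eval_hasseDeriv_add {F : Type*} [Field F] (P : Fin 3 → F) (a : Fin 3 →₀ ℕ)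
    (G H : MvPolynomial (Fin 3) F) :
    eval P (hasseDeriv a (G + H)) = eval P (hasseDeriv a G) + eval P (hasseDeriv a H) := by
  classical
  rw [eval_hasseDeriv P a (G + H) (G.support ∪ H.support) support_add,
    eval_hasseDeriv P a G (G.support ∪ H.support) Finset.subset_union_left,
    eval_hasseDeriv P a H (G.support ∪ H.support) Finset.subset_union_right,
    ← Finset.sum_add_distrib]
  exact Finset.sum_congr rfl fun p _ => by rw [coeff_add]; ring

theorem eval_hasseDeriv_C_mul {F : Type*} [Field F] (P : Fin 3 → F) (a : Fin 3 →₀ ℕ) (c : F)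
    (G : MvPolynomial (Fin 3) F) :
    eval P (hasseDeriv a (C c * G)) = c * eval P (hasseDeriv a G) := by
  have h : (C c * G).support ⊆ G.support := by
    intro p hp
    rw [mem_support_iff, coeff_C_mul] at hp
    exact mem_support_iff.mpr (right_ne_zero_of_mul hp)
  rw [eval_hasseDeriv P a _ _ h, eval_hasseDeriv P a G _ subset_rfl, Finset.mul_sum]
  exact Finset.sum_congr rfl fun p _ => by rw [coeff_C_mul]; ring

theorem eval_hasseDeriv_monomial {F : Type*} [Field F] (P : Fin 3 → F) (a p : Fin 3 →₀ ℕ)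
    (c : F) :
    eval P (hasseDeriv a (monomial p c)) =
      (∏ i, ((p i).choose (a i) * P i ^ (p i - a i))) * c := by
  rw [eval_hasseDeriv P a _ {p} support_monomial_subset, Finset.sum_singleton, coeff_monomial,
    if_pos rfl]

theorem choose_mul_pow_succ {F : Type*} [Field F] (x : F) (p a : ℕ) :
    (((p + 1).choose a : ℕ) : F) * x ^ (p + 1 - a) =
      x * ((p.choose a : F) * x ^ (p - a)) +
        if a = 0 then 0 else (p.choose (a - 1) : F) * x ^ (p - (a - 1)) := by
  cases a with
  | zero => simp; ring
  | succ a =>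
    rw [Nat.choose_succ_succ]
    simp only [Nat.add_sub_add_right, Nat.add_sub_cancel, Nat.succ_ne_zero, if_false]
    rcases Nat.lt_or_ge p (a + 1) with h | h
    · simp [Nat.choose_eq_zero_of_lt h]
    · have : p - a = p - (a + 1) + 1 := by omega
      rw [this]
      push_cast
      ring

theorem eval_hasseDeriv_mul_X {F : Type*} [Field F] (P : Fin 3 → F) (a : Fin 3 →₀ ℕ) (i : Fin 3)
    (G : MvPolynomial (Fin 3) F) :
    eval P (hasseDeriv a (G * X i)) = P i * eval P (hasseDeriv a G) +
      if a i = 0 then 0 else eval P (hasseDeriv (a - Finsupp.single i 1) G) := by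
  induction G using MvPolynomial.induction_on' with
  | monomial p c =>
    have hX : (monomial p c : MvPolynomial (Fin 3) F) * X i =
        monomial (p + Finsupp.single i 1) c := by
      rw [X, monomial_mul, mul_one]
    rw [hX]
    simp only [eval_hasseDeriv_monomial, Fin.prod_univ_three]
    fin_cases i <;>
    · simp [choose_mul_pow_succ]
      split_ifs <;> ring
  | add G H hG hH =>
    rw [add_mul]
    simp only [eval_hasseDeriv_add, hG, hH]
    split_ifs <;> ring

theorem HasMultiplicity.zero {F : Type*} [Field F] (m : ℕ) (P : Fin 3 → F) :
    HasMultiplicity m 0 P := by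
  intro a _
  simp [hasseDeriv]

theorem HasMultiplicity.add {F : Type*} [Field F] {m : ℕ} {P : Fin 3 → F}
    {G H : MvPolynomial (Fin 3) F} (hG : HasMultiplicity m G P) (hH : HasMultiplicity m H P) :
    HasMultiplicity m (G + H) P := by
  intro a ha
  rw [eval_hasseDeriv_add, hG a ha, hH a ha, add_zero]

theorem HasMultiplicity.mul_left {F : Type*} [Field F] {m : ℕ} {P : Fin 3 → F}
    {G : MvPolynomial (Fin 3) F} (hG : HasMultiplicity m G P) (H : MvPolynomial (Fin 3) F) :
    HasMultiplicity m (H * G) P := by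
  induction H using MvPolynomial.induction_on with
  | C c =>
    intro a ha
    rw [eval_hasseDeriv_C_mul, hG a ha, mul_zero]
  | add H K hH hK =>
    rw [add_mul]
    exact hH.add hK
  | mul_X H i hH =>
    intro a ha
    rw [mul_right_comm, eval_hasseDeriv_mul_X, hH a ha, mul_zero, zero_add]
    split_ifs with h
    · rfl
    · apply hH
      have h0 := Nat.sub_le (a 0) ((Finsupp.single i 1 : Fin 3 →₀ ℕ) 0)
      have h1 := Nat.sub_le (a 1) ((Finsupp.single i 1 : Fin 3 →₀ ℕ) 1)
      have h2 := Nat.sub_le (a 2) ((Finsupp.single i 1 : Fin 3 →₀ ℕ) 2)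
      simp only [Finsupp.tsub_apply]
      omega

/-! ### Codes -/

/-- The generalized Reed-Solomon code with locators `α`, column multipliers `β` and
dimension `k`. -/
def grsCode {F : Type*} [Field F] {n : ℕ} (α β : Fin n → F) (k : ℕ) : Set (Fin n → F) :=
  {v | ∃ f : Polynomial F, f.degree < k ∧ ∀ s, v s = β s * f.eval (α s)}

/-- The binary alternant code: the binary words in the generalized Reed-Solomon code. -/
def alternantCode {F : Type*} [Field F] [Algebra (ZMod 2) F] {n : ℕ} (α β : Fin n → F) (k : ℕ) :
    Set (Fin n → ZMod 2) :=
  {c | (fun s => algebraMap (ZMod 2) F (c s)) ∈ grsCode α β k}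

/-- The `2`-interleaved alternant code: both rows lie in the alternant code. -/
def interleavedCode {F : Type*} [Field F] [Algebra (ZMod 2) F] {n : ℕ} (α β : Fin n → F) (k : ℕ) :
    Set (Matrix (Fin 2) (Fin n) (ZMod 2)) :=
  {C | ∀ i, C i ∈ alternantCode α β k}

/-- The designed minimum distance `n - k + 1` (for `k ≤ n`). -/
def designedDistance (n k : ℕ) : ℕ := n - k + 1

/-- The binary Johnson radius `⌈(n - n √(1 - 2d/n)) / 2 - 1⌉`. -/
noncomputable def binaryJohnsonRadius (n d : ℕ) : ℤ :=
  ⌈((n : ℝ) - n * √(1 - 2 * d / n)) / 2 - 1⌉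

/-! ### The interpolation step -/

/-- The point `(α_s, β_s⁻¹ γ₁, β_s⁻¹ γ₂)`. -/
noncomputable def interpolationPoint {F : Type*} [Field F] [Algebra (ZMod 2) F] {n : ℕ}
    (α β : Fin n → F) (s : Fin n) (γ₁ γ₂ : ZMod 2) : Fin 3 → F :=
  ![α s, (β s)⁻¹ * algebraMap (ZMod 2) F γ₁, (β s)⁻¹ * algebraMap (ZMod 2) F γ₂]

/-- The multiplicity required at `(α_s, β_s⁻¹ γ₁, β_s⁻¹ γ₂)` for the received word `R`: `m₁` at
the received symbol pair, `m₂` at the three other pairs. -/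
def requiredMultiplicity {n : ℕ} (R : Matrix (Fin 2) (Fin n) (ZMod 2)) (m₁ m₂ : ℕ) (s : Fin n)
    (γ₁ γ₂ : ZMod 2) : ℕ :=
  if γ₁ = R 0 s ∧ γ₂ = R 1 s then m₁ else m₂

/-- The ideal of all polynomials that satisfy the interpolation constraints. -/
def interpolationIdeal {F : Type*} [Field F] [Algebra (ZMod 2) F] {n : ℕ} (α β : Fin n → F)
    (R : Matrix (Fin 2) (Fin n) (ZMod 2)) (m₁ m₂ : ℕ) : Ideal (MvPolynomial (Fin 3) F) where
  carrier := {G | ∀ s γ₁ γ₂, HasMultiplicity (requiredMultiplicity R m₁ m₂ s γ₁ γ₂) G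
    (interpolationPoint α β s γ₁ γ₂)}
  add_mem' hG hH s γ₁ γ₂ := (hG s γ₁ γ₂).add (hH s γ₁ γ₂)
  zero_mem' _ _ _ := HasMultiplicity.zero _ _
  smul_mem' H _ hG s γ₁ γ₂ := (hG s γ₁ γ₂).mul_left H

/-- `G` is a possible output of the interpolation step: a Gröbner basis of the interpolation ideal
with respect to `≺_w`, `w = (1, k - 1, k - 1)`, listed in ascending order of weighted degree. -/
def IsInterpolationOutput {F : Type*} [Field F] [Algebra (ZMod 2) F] {n : ℕ} (α β : Fin n → F)
    (k : ℕ) (R : Matrix (Fin 2) (Fin n) (ZMod 2)) (m₁ m₂ : ℕ)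
    (G : List (MvPolynomial (Fin 3) F)) : Prop :=
  IsGroebnerBasis (weightedOrder (weights k)) (interpolationIdeal α β R m₁ m₂) G ∧
    G.Pairwise fun P Q =>
      weightedTotalDegree (weights k) P ≤ weightedTotalDegree (weights k) Q

/-! ### The recovery step -/

/-- A greatest common divisor in `F[X, Y, Z]` (unique up to a nonzero constant). -/
noncomputable def polyGcd {F : Type*} [Field F] (P Q : MvPolynomial (Fin 3) F) :
    MvPolynomial (Fin 3) F :=
  letI := UniqueFactorizationMonoid.toGCDMonoid (MvPolynomial (Fin 3) F)
  GCDMonoid.gcd P Q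

/-- The loop of the recovery step. `Q` is the greatest common divisor of the basis polynomials
processed so far. The loop stops at the first polynomial `P` for which `gcd(Q, P)` involves neither
`Y` nor `Z`, and then returns the weighted degree of `P`; since the basis is sorted, this is the
maximal weighted degree of the polynomials used. `none` is a decoding failure. -/
noncomputable def recoveryLoop {F : Type*} [Field F] (k : ℕ) (Q : MvPolynomial (Fin 3) F) :
    List (MvPolynomial (Fin 3) F) → Option ℕ
  | [] => none
  | P :: L =>
    if degreeOf 1 (polyGcd Q P) = 0 ∧ degreeOf 2 (polyGcd Q P) = 0 then
      some (weightedTotalDegree (weights k) P)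
    else recoveryLoop k (polyGcd Q P) L

/-- The weighted degree reached by the recovery step, or `none` for a decoding failure. -/
noncomputable def recoveryDegree {F : Type*} [Field F] (k : ℕ) :
    List (MvPolynomial (Fin 3) F) → Option ℕ
  | [] => none
  | Q :: L => recoveryLoop k Q L

/-- The achieved decoding radius `(n - Δ / m₁) / (1 - m₂ / m₁)`, where `Δ` is the weighted degree
reached by the recovery step; `none` is a decoding failure. -/
noncomputable def achievedRadius {F : Type*} [Field F] (n k m₁ m₂ : ℕ)
    (G : List (MvPolynomial (Fin 3) F)) : Option ℝ :=
  (recoveryDegree k G).map fun Δ => ((n : ℝ) - Δ / m₁) / (1 - (m₂ : ℝ) / m₁)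

end InterleavedAlternant

open InterleavedAlternant

namespace InterleavedAlternant

/-! ### Weighted degrees and the monomial ordering -/

/-! Let `R` be any received matrix and `D = m₁ (n - t) + m₂ t`, with `t` the Johnson radius. Each
row of `R` can be interpolated alone: `exists_mem_interpolationIdeal` yields nonzero ideal members
`Q₁(X, Y)` and `Q₂(X, Z)` of weighted degree below `D`. Counting monomials against constraints, for
large multiplicities this needs `n (k - 1) (1 + ρ²) < (n - t + ρ t)²` with `ρ = m₂ / m₁`; at `ρ = t
/ (n - t)` it is the Johnson inequality `n (k - 1) < (n - t)² + t²`, and continuity gives `ε` and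
`M` (`exists_count_lt`).

A common divisor of `Q₁` and `Q₂` lies in `F[X]`. The ordering refines the weighted degree, so a
common divisor of the basis elements below `D` divides both
(`IsGroebnerBasis.dvd_of_weightedTotalDegree_lt`). Hence the gcd loses `Y` and `Z` before the list
reaches `D`. The loop needs a second element below `D`: if the first were alone there, it would lie
in `F[X]` and, having `n` zeros of multiplicity `m₁`, have degree at least `n m₁ ≥ D`. Finally,
degree exactly `D` would give radius exactly `t`, so a degree below `D` gives more. -/

theorem weight_eq_monomialWeight (w : Fin 3 → ℕ) (a : Fin 3 →₀ ℕ) :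
    Finsupp.weight w a = monomialWeight w a := by
  rw [Finsupp.weight_apply, Finsupp.sum_fintype _ _ (by simp), Fin.sum_univ_three]
  simp only [smul_eq_mul, monomialWeight]
  ring

theorem monomialWeight_add (w : Fin 3 → ℕ) (a b : Fin 3 →₀ ℕ) :
    monomialWeight w (a + b) = monomialWeight w a + monomialWeight w b := by
  simp only [monomialWeight, Finsupp.add_apply]
  ring

theorem monomialWeight_le_of_toSyn_le {w : Fin 3 → ℕ} {a b : Fin 3 →₀ ℕ}
    (h : (weightedOrder w).toSyn a ≤ (weightedOrder w).toSyn b) :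
    monomialWeight w a ≤ monomialWeight w b :=
  (Prod.Lex.toLex_le_toLex.mp (show orderKey w a ≤ orderKey w b from h)).elim le_of_lt
    fun h' => h'.1.le

theorem weightedTotalDegree_eq_monomialWeight_degree {F : Type*} [Field F] (w : Fin 3 → ℕ)
    {f : MvPolynomial (Fin 3) F} (hf : f ≠ 0) :
    weightedTotalDegree w f = monomialWeight w ((weightedOrder w).degree f) := by
  apply le_antisymm
  · refine Finset.sup_le fun p hp => ?_
    rw [weight_eq_monomialWeight]
    exact monomialWeight_le_of_toSyn_le ((weightedOrder w).le_degree hp)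
  · rw [← weight_eq_monomialWeight]
    exact le_weightedTotalDegree w ((weightedOrder w).degree_mem_support hf)

/-- Division by a Gröbner basis only uses basis elements of small weighted degree: a common divisor
of the basis elements of weighted degree below `D` divides every element of the ideal of weighted
degree below `D`. -/
theorem IsGroebnerBasis.dvd_of_weightedTotalDegree_lt {F : Type*} [Field F] {w : Fin 3 → ℕ}
    {I : Ideal (MvPolynomial (Fin 3) F)} {G : List (MvPolynomial (Fin 3) F)}
    (hG : IsGroebnerBasis (weightedOrder w) I G) {D : ℕ} {h f : MvPolynomial (Fin 3) F}
    (hh : ∀ g ∈ G, weightedTotalDegree w g < D → h ∣ g) (hf : f ∈ I)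
    (hfD : weightedTotalDegree w f < D) : h ∣ f := by
  obtain ⟨q, r, hfq, hdeg, hr⟩ := (weightedOrder w).div_set (B := {g | g ∈ G})
    (fun b hb => isUnit_iff_ne_zero.mpr
      ((weightedOrder w).leadingCoeff_ne_zero_iff.mpr (hG.1 b hb).2)) f
  rw [Finsupp.linearCombination_apply, Finsupp.sum] at hfq
  -- The remainder lies in `I`, but none of its monomials is divisible by a leading monomial of the
  -- basis.
  have hr0 : r = 0 := by
    by_contra hr0
    have hrI : r ∈ I := by
      rw [eq_sub_of_add_eq' hfq.symm]
      exact I.sub_mem hf (I.sum_mem fun b _ => I.mul_mem_left _ (hG.1 b.1 b.2).1)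
    obtain ⟨g, hg, hgr⟩ := hG.2 r hrI hr0
    exact hr _ ((weightedOrder w).degree_mem_support hr0) g hg hgr
  rcases eq_or_ne f 0 with rfl | hf0
  · exact dvd_zero h
  rw [hfq, hr0, add_zero]
  refine Finset.dvd_sum fun b hb => dvd_mul_of_dvd_right (hh b.1 b.2 ?_) _
  have hb0 := (hG.1 b.1 b.2).2
  have hle := monomialWeight_le_of_toSyn_le (hdeg b)
  rw [(weightedOrder w).degree_mul hb0 (Finsupp.mem_support_iff.mp hb), monomialWeight_add,
    ← weightedTotalDegree_eq_monomialWeight_degree w hb0,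
    ← weightedTotalDegree_eq_monomialWeight_degree w hf0] at hle
  omega

theorem degreeOf_eq_zero_of_dvd {σ F : Type*} [Field F] {f g : MvPolynomial σ F}
    (hfg : f ∣ g) (hg : g ≠ 0) {i : σ} (hi : degreeOf i g = 0) : degreeOf i f = 0 := by
  obtain ⟨h, rfl⟩ := hfg
  rw [degreeOf_mul_eq (left_ne_zero_of_mul hg) (right_ne_zero_of_mul hg)] at hi
  omega

/-! ### The recovery loop -/

theorem polyGcd_dvd_left {F : Type*} [Field F] (P Q : MvPolynomial (Fin 3) F) :
    polyGcd P Q ∣ P := by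
  let := UniqueFactorizationMonoid.toGCDMonoid (MvPolynomial (Fin 3) F)
  exact GCDMonoid.gcd_dvd_left P Q

theorem polyGcd_dvd_right {F : Type*} [Field F] (P Q : MvPolynomial (Fin 3) F) :
    polyGcd P Q ∣ Q := by
  let := UniqueFactorizationMonoid.toGCDMonoid (MvPolynomial (Fin 3) F)
  exact GCDMonoid.gcd_dvd_right P Q

/-- Sortedness puts all elements below `D` first. `hfree` is phrased with common divisors rather
than a gcd, so it passes from `Q` to `polyGcd Q P` in the induction. -/
theorem exists_recoveryLoop_eq_some {F : Type*} [Field F] {k D : ℕ}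
    (L : List (MvPolynomial (Fin 3) F)) (Q : MvPolynomial (Fin 3) F)
    (hL : L.Pairwise fun P Q =>
      weightedTotalDegree (weights k) P ≤ weightedTotalDegree (weights k) Q)
    (hex : ∃ P ∈ L, weightedTotalDegree (weights k) P < D)
    (hfree : ∀ h, h ∣ Q → (∀ P ∈ L, weightedTotalDegree (weights k) P < D → h ∣ P) →
      degreeOf 1 h = 0 ∧ degreeOf 2 h = 0) :
    ∃ Δ < D, recoveryLoop k Q L = some Δ := by
  induction L generalizing Q with
  | nil => simp at hex
  | cons P L ih =>
    rw [List.pairwise_cons] at hL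
    have hP : weightedTotalDegree (weights k) P < D := by
      obtain ⟨P', hP', hlt⟩ := hex
      rcases List.mem_cons.mp hP' with rfl | hP'
      · exact hlt
      · exact (hL.1 P' hP').trans_lt hlt
    rw [recoveryLoop]
    split_ifs with hc
    · exact ⟨_, hP, rfl⟩
    · refine ih _ hL.2 ?_ fun h hh hhL => ?_
      -- If `P` were the last element below `D`, the current gcd would be a common divisor as in
      -- `hfree`, and the loop would have stopped.
      · by_contra! hno
        refine hc (hfree _ (polyGcd_dvd_left Q P) fun P' hP' hlt => ?_)
        rcases List.mem_cons.mp hP' with rfl | hP'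
        · exact polyGcd_dvd_right _ _
        · exact absurd hlt (hno P' hP').not_gt
      · refine hfree h (hh.trans (polyGcd_dvd_left Q P)) fun P' hP' hlt => ?_
        rcases List.mem_cons.mp hP' with rfl | hP'
        · exact hh.trans (polyGcd_dvd_right _ _)
        · exact hhL P' hP' hlt

/-! ### Multiplicities -/

theorem HasMultiplicity.mono {F : Type*} [Field F] {m m' : ℕ} {P : Fin 3 → F}
    {G : MvPolynomial (Fin 3) F} (hG : HasMultiplicity m G P) (h : m' ≤ m) :
    HasMultiplicity m' G P :=
  fun a ha => hG a (ha.trans_le h)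

theorem eval_hasseDeriv_sum {F ι : Type*} [Field F] (P : Fin 3 → F) (a : Fin 3 →₀ ℕ)
    (s : Finset ι) (G : ι → MvPolynomial (Fin 3) F) :
    eval P (hasseDeriv a (∑ q ∈ s, G q)) = ∑ q ∈ s, eval P (hasseDeriv a (G q)) := by
  classical
  induction s using Finset.induction_on with
  | empty => simp [hasseDeriv]
  | insert q s hq ih => rw [Finset.sum_insert hq, Finset.sum_insert hq, eval_hasseDeriv_add, ih]

/-- A nonzero polynomial in `X` alone that passes with multiplicity `m` through points with
distinct first coordinates has degree at least `m` times the number of points. -/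
theorem card_mul_le_weightedTotalDegree {F ι : Type*} [Field F] [Fintype ι] {m : ℕ}
    {G : MvPolynomial (Fin 3) F} (hG : G ≠ 0) (h1 : degreeOf 1 G = 0) (h2 : degreeOf 2 G = 0)
    {P : ι → Fin 3 → F} (hP : Function.Injective fun j => P j 0)
    (hm : ∀ j, HasMultiplicity m G (P j)) {w : Fin 3 → ℕ} (hw : w 0 = 1) :
    Fintype.card ι * m ≤ weightedTotalDegree w G := by
  have hsupp : ∀ q ∈ G.support, q 1 = 0 ∧ q 2 = 0 := fun q hq =>
    ⟨Nat.le_zero.mp (degreeOf_le_iff.mp h1.le q hq), Nat.le_zero.mp (degreeOf_le_iff.mp h2.le q hq)⟩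
  set p : Polynomial F := ∑ q ∈ G.support, Polynomial.monomial (q 0) (coeff q G) with hp
  have hpG : Polynomial.aeval (X 0 : MvPolynomial (Fin 3) F) p = G := by
    conv_rhs => rw [G.as_sum]
    rw [hp, map_sum]
    refine Finset.sum_congr rfl fun q hq => ?_
    rw [Polynomial.aeval_monomial, monomial_eq, Finsupp.prod_fintype _ _ (by simp),
      Fin.prod_univ_three, (hsupp q hq).1, (hsupp q hq).2]
    simp [algebraMap_eq]
  have hp0 : p ≠ 0 := by
    rintro h
    rw [h, map_zero] at hpG
    exact hG hpG.symm
  have hdeg : p.natDegree ≤ weightedTotalDegree w G := by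
    refine Polynomial.natDegree_sum_le_of_forall_le _ _ fun q hq => ?_
    refine (Polynomial.natDegree_monomial_le _).trans ?_
    refine le_trans ?_ (le_weightedTotalDegree w hq)
    rw [weight_eq_monomialWeight, monomialWeight, hw]
    omega
  -- The Hasse derivatives of order `(a, 0, 0)` at `P j` are the Taylor coefficients of `p` at `P j
  -- 0`.
  have hdvd : ∀ j, (Polynomial.X - Polynomial.C (P j 0)) ^ m ∣ p := by
    intro j
    rw [Polynomial.X_sub_C_pow_dvd_iff, ← Polynomial.taylor_apply, Polynomial.X_pow_dvd_iff]
    intro a ha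
    rw [Polynomial.taylor_coeff, ← hm j (Finsupp.single 0 a) (by simpa using ha),
      eval_hasseDeriv _ _ _ _ subset_rfl, hp, map_sum, Polynomial.eval_finsetSum]
    refine Finset.sum_congr rfl fun q hq => ?_
    rw [Polynomial.hasseDeriv_monomial, Polynomial.eval_monomial, Fin.prod_univ_three]
    simp [hsupp q hq]
    ring
  have hprod : ∏ j, (Polynomial.X - Polynomial.C (P j 0)) ^ m ∣ p :=
    Fintype.prod_dvd_of_coprime
      (fun i j hij => (Polynomial.pairwise_coprime_X_sub_C hP hij).pow) hdvd
  refine le_trans ?_ hdeg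
  refine le_trans ?_ (Polynomial.natDegree_le_of_dvd hprod hp0)
  rw [Polynomial.natDegree_prod_of_monic _ _ fun j _ => (Polynomial.monic_X_sub_C _).pow m]
  simp

/-! ### Interpolation by polynomials in two of the variables -/

/-- Telescoping `x² ≤ 2 κ x + (x - κ)²`, which also holds for truncated subtraction when `x ≤ κ`. -/
theorem sq_le_two_mul_sum_add_sq (κ D B : ℕ) :
    D ^ 2 ≤ 2 * κ * ∑ b ∈ Finset.range B, (D - κ * b) + (D - κ * B) ^ 2 := by
  induction B with
  | zero => simp
  | succ B ih =>
    rw [Finset.sum_range_succ, mul_add κ B, mul_one, ← Nat.sub_sub]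
    refine ih.trans ?_
    generalize D - κ * B = x
    rcases le_total κ x with h | h
    · obtain ⟨y, rfl⟩ := Nat.exists_eq_add_of_le h
      rw [Nat.add_sub_cancel_left]
      nlinarith
    · rw [Nat.sub_eq_zero_of_le h]
      nlinarith

/-- There are at least `D² / (2κ)` monomials of `(1, κ)`-weighted degree below `D`. -/
theorem sq_le_two_mul_sum {κ : ℕ} (hκ : 0 < κ) (D : ℕ) :
    D ^ 2 ≤ 2 * κ * ∑ b ∈ Finset.range D, (D - κ * b) := by
  have h := sq_le_two_mul_sum_add_sq κ D D
  rwa [Nat.sub_eq_zero_of_le (Nat.le_mul_of_pos_left D hκ), zero_pow two_ne_zero, add_zero] at h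

theorem two_mul_sum_range_sub (m : ℕ) : 2 * ∑ a ∈ Finset.range m, (m - a) = m * (m + 1) := by
  induction m with
  | zero => simp
  | succ m ih =>
    rw [Finset.sum_range_succ', mul_add]
    simp only [Nat.add_sub_add_right, ih, Nat.sub_zero]
    ring

/-- If the number of monomials of `(1, κ)`-weighted degree below `D` exceeds the number of linear
constraints, then there is a nonzero polynomial in `X` and the `i`-th variable only, of weighted
degree below `D`, that passes through all the given lines with the given multiplicities. -/
theorem exists_interpolant_two_variables {F ι : Type*} [Field F] [Fintype ι] {κ D : ℕ}
    (hκ : 0 < κ) (x u : ι → F) (μ : ι → ℕ) (hcount : κ * ∑ j, μ j * (μ j + 1) < D ^ 2)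
    {i : Fin 3} (hi : i ≠ 0) :
    ∃ Q : MvPolynomial (Fin 3) F, Q ≠ 0 ∧
      (∀ p ∈ Q.support, (∀ o, o ≠ 0 → o ≠ i → p o = 0) ∧ p 0 + κ * p i < D) ∧
      ∀ (j : ι) (P : Fin 3 → F), P 0 = x j → P i = u j → HasMultiplicity (μ j) Q P := by
  classical
  -- Rows are the Hasse conditions of total order below `μ j`, columns the monomials of weighted
  -- degree below `D`; a kernel vector lists the coefficients of `Q`.
  let A : Matrix (Σ j : ι, Σ a : Fin (μ j), Fin (μ j - a)) (Σ b : Fin D, Fin (D - κ * b)) F :=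
    fun e q => ((q.2 : ℕ).choose e.2.1 * x e.1 ^ ((q.2 : ℕ) - e.2.1)) *
      ((q.1 : ℕ).choose e.2.2 * u e.1 ^ ((q.1 : ℕ) - e.2.2))
  have hker : LinearMap.ker A.mulVecLin ≠ ⊥ := by
    apply LinearMap.ker_ne_bot_of_finrank_lt
    simp only [Module.finrank_fintype_fun_eq_card, Fintype.card_sigma, Fintype.card_fin]
    rw [Fin.sum_univ_eq_sum_range fun b => D - κ * b]
    have h1 : ∀ j, ∑ a : Fin (μ j), (μ j - a) = ∑ a ∈ Finset.range (μ j), (μ j - a) := fun j =>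
      Fin.sum_univ_eq_sum_range (fun a => μ j - a) _
    simp only [h1]
    refine Nat.lt_of_mul_lt_mul_left (a := 2 * κ) (lt_of_lt_of_le ?_ (sq_le_two_mul_sum hκ D))
    rw [mul_comm 2 κ, mul_assoc, Finset.mul_sum]
    simpa only [two_mul_sum_range_sub] using hcount
  obtain ⟨c, hc, hc0⟩ := (Submodule.ne_bot_iff _).mp hker
  rw [LinearMap.mem_ker, Matrix.mulVecLin_apply] at hc
  let e : (Σ b : Fin D, Fin (D - κ * b)) → (Fin 3 →₀ ℕ) := fun q =>
    Finsupp.single 0 (q.2 : ℕ) + Finsupp.single i (q.1 : ℕ)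
  have he0 : ∀ q, e q 0 = q.2 := fun q => by simp [e, hi]
  have hei : ∀ q, e q i = q.1 := fun q => by simp [e, hi.symm]
  have heo : ∀ q o, o ≠ 0 → o ≠ i → e q o = 0 := fun q o h0 hoi => by
    simp [e, h0, hoi]
  have he : Function.Injective e := by
    rintro ⟨b, a⟩ ⟨b', a'⟩ h
    have hb : b = b' := Fin.ext (by simpa [hei] using DFunLike.congr_fun h i)
    subst hb
    have ha : a = a' := Fin.ext (by simpa [he0] using DFunLike.congr_fun h 0)
    rw [ha]
  refine ⟨∑ q, monomial (e q) (c q), ?_, ?_, ?_⟩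
  · obtain ⟨q, hq⟩ := Function.ne_iff.mp hc0
    intro h
    have := congrArg (coeff (e q)) h
    simp only [coeff_sum, coeff_monomial, he.eq_iff, coeff_zero, Finset.sum_ite_eq',
      Finset.mem_univ, if_true] at this
    exact hq this
  · intro p hp
    obtain ⟨q, -, hq⟩ := Finset.mem_biUnion.mp (support_sum hp)
    rw [Finset.mem_singleton.mp (support_monomial_subset hq)]
    refine ⟨heo q, ?_⟩
    rw [he0, hei]
    have := q.2.2
    omega
  · intro j P hP0 hPi a ha
    rw [eval_hasseDeriv_sum]
    simp only [eval_hasseDeriv_monomial]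
    have hprod : ∀ f : Fin 3 → F, ∏ o, f o = f 0 * f i * ∏ o ∈ {0, i}ᶜ, f o := fun f => by
      rw [← Finset.prod_mul_prod_compl {0, i}, Finset.prod_pair hi.symm]
    simp only [hprod, he0, hei, hP0, hPi]
    -- The absent variable contributes a factor common to all monomials, so every condition is a
    -- multiple of a row of `A`.
    have hrest : ∀ q, ∏ o ∈ ({0, i} : Finset (Fin 3))ᶜ,
        (((e q o).choose (a o) : ℕ) * P o ^ (e q o - a o) : F) =
        ∏ o ∈ ({0, i} : Finset (Fin 3))ᶜ, ((Nat.choose 0 (a o) : ℕ) : F) := fun q => by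
      refine Finset.prod_congr rfl fun o ho => ?_
      simp only [Finset.mem_compl, Finset.mem_insert, Finset.mem_singleton, not_or] at ho
      rw [heo q o ho.1 ho.2, Nat.zero_sub, pow_zero, mul_one]
    have hlt : a 0 + a i < μ j := by
      refine lt_of_le_of_lt ?_ ha
      fin_cases i
      · exact absurd rfl hi
      · exact Nat.le_add_right _ _
      · exact Nat.add_le_add_right (Nat.le_add_right _ _) _
    have hrow := congrFun hc ⟨j, ⟨a 0, by omega⟩, ⟨a i, by simp only; omega⟩⟩
    simp only [hrest]
    rw [Matrix.mulVec, dotProduct, Pi.zero_apply] at hrow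
    calc _ = (∏ o ∈ ({0, i} : Finset (Fin 3))ᶜ, ((Nat.choose 0 (a o) : ℕ) : F)) * _ := by
          rw [Finset.mul_sum]
          refine Finset.sum_congr rfl fun q _ => ?_
          rw [mul_right_comm, mul_comm]
      _ = 0 := by rw [hrow, mul_zero]

/-! ### The decoder reaches the Johnson radius -/

theorem weightedTotalDegree_weights_lt {F : Type*} [Field F] {k D : ℕ} (hD : 0 < D) {i : Fin 3}
    (hi : i ≠ 0) {Q : MvPolynomial (Fin 3) F}
    (hQ : ∀ p ∈ Q.support, (∀ o, o ≠ 0 → o ≠ i → p o = 0) ∧ p 0 + (k - 1) * p i < D) :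
    weightedTotalDegree (weights k) Q < D := by
  refine (Finset.sup_lt_iff hD).mpr fun p hp => ?_
  obtain ⟨h0, hlt⟩ := hQ p hp
  rw [weight_eq_monomialWeight, monomialWeight]
  fin_cases i
  · exact absurd rfl hi
  · have := h0 2 (by decide) (by decide)
    simpa [weights, this] using hlt
  · have := h0 1 (by decide) (by decide)
    simpa [weights, this] using hlt

/-- The cost of interpolating a single row of the received word. -/
theorem sum_rowMultiplicity {n : ℕ} (y : Fin n → ZMod 2) (m₁ m₂ : ℕ) :
    ∑ j : Fin n × ZMod 2, (if j.2 = y j.1 then m₁ else m₂) *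
        ((if j.2 = y j.1 then m₁ else m₂) + 1) =
      n * (m₁ * (m₁ + 1) + m₂ * (m₂ + 1)) := by
  have h : ∀ v : ZMod 2, ∑ γ : ZMod 2, (if γ = v then m₁ else m₂) *
      ((if γ = v then m₁ else m₂) + 1) = m₁ * (m₁ + 1) + m₂ * (m₂ + 1) := by
    intro v
    rw [show (Finset.univ : Finset (ZMod 2)) = {v, v + 1} by decide +revert,
      Finset.sum_pair (by decide +revert), if_pos rfl, if_neg (by decide +revert)]
  rw [Fintype.sum_prod_type]
  simp only [h]
  simp

/-- The interpolation ideal contains nonzero polynomials of small weighted degree in `X` and one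
further variable: interpolation of a single row of the received word. -/
theorem exists_mem_interpolationIdeal {F : Type*} [Field F] [Algebra (ZMod 2) F] {n k D : ℕ}
    (hk : 1 < k) (α β : Fin n → F) (R : Matrix (Fin 2) (Fin n) (ZMod 2)) {m₁ m₂ : ℕ}
    (hm : m₂ ≤ m₁)
    (hcount : (k - 1) * (n * (m₁ * (m₁ + 1) + m₂ * (m₂ + 1))) < D ^ 2) (r : Fin 2) :
    ∃ Q ∈ interpolationIdeal α β R m₁ m₂, Q ≠ 0 ∧ weightedTotalDegree (weights k) Q < D ∧
      ∀ o : Fin 3, o ≠ 0 → o ≠ r.succ → degreeOf o Q = 0 := by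
  have hD : 0 < D := by
    by_contra h
    simp [Nat.eq_zero_of_not_pos h] at hcount
  rw [← sum_rowMultiplicity (R r)] at hcount
  obtain ⟨Q, hQ0, hQ, hmul⟩ := exists_interpolant_two_variables (by omega : 0 < k - 1)
    (fun j : Fin n × ZMod 2 => α j.1) (fun j => (β j.1)⁻¹ * algebraMap (ZMod 2) F j.2)
    (fun j => if j.2 = R r j.1 then m₁ else m₂) hcount (Fin.succ_ne_zero r)
  refine ⟨Q, fun s γ₁ γ₂ => ?_, hQ0, weightedTotalDegree_weights_lt hD (Fin.succ_ne_zero r) hQ,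
    fun o ho hor => Nat.le_zero.mp (degreeOf_le_iff.mpr fun p hp => ((hQ p hp).1 o ho hor).le)⟩
  -- The multiplicity of `Q` depends only on the symbol in row `r`: it is `m₁` wherever that symbol
  -- is the received one, which is at least the requirement since `m₂ ≤ m₁`.
  refine (hmul (s, ![γ₁, γ₂] r) _ rfl ?_).mono ?_
  · fin_cases r <;> rfl
  · unfold requiredMultiplicity
    fin_cases r <;> simp <;> split_ifs <;> simp_all

/-- The row interpolants are witnesses only: the decoder never computes them, but they control the
gcd of the basis elements below `D`. The bound `D ≤ n * m₁` is what excludes a single basis element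
below `D`. -/
theorem exists_recoveryDegree_eq_some {F : Type*} [Field F] [Algebra (ZMod 2) F] {n k D : ℕ}
    (hk : 1 < k) {α β : Fin n → F} (hα : Function.Injective α)
    {R : Matrix (Fin 2) (Fin n) (ZMod 2)} {m₁ m₂ : ℕ} (hm : m₂ ≤ m₁) (hD : D ≤ n * m₁)
    (hcount : (k - 1) * (n * (m₁ * (m₁ + 1) + m₂ * (m₂ + 1))) < D ^ 2)
    {G : List (MvPolynomial (Fin 3) F)} (hG : IsInterpolationOutput α β k R m₁ m₂ G) :
    ∃ Δ < D, recoveryDegree k G = some Δ := by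
  obtain ⟨Q₁, hQ₁, hQ₁0, hQ₁D, hQ₁deg⟩ := exists_mem_interpolationIdeal hk α β R hm hcount 0
  obtain ⟨Q₂, hQ₂, hQ₂0, hQ₂D, hQ₂deg⟩ := exists_mem_interpolationIdeal hk α β R hm hcount 1
  obtain ⟨hGB, hsort⟩ := hG
  have hfree : ∀ h, (∀ P ∈ G, weightedTotalDegree (weights k) P < D → h ∣ P) →
      degreeOf 1 h = 0 ∧ degreeOf 2 h = 0 := fun h hh =>
    ⟨degreeOf_eq_zero_of_dvd (hGB.dvd_of_weightedTotalDegree_lt hh hQ₂ hQ₂D) hQ₂0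
        (hQ₂deg 1 (by decide) (by decide)),
      degreeOf_eq_zero_of_dvd (hGB.dvd_of_weightedTotalDegree_lt hh hQ₁ hQ₁D) hQ₁0
        (hQ₁deg 2 (by decide) (by decide))⟩
  cases G with
  | nil =>
    obtain ⟨g, hg, -⟩ := hGB.2 Q₁ hQ₁ hQ₁0
    simp at hg
  | cons Q L =>
    rw [List.pairwise_cons] at hsort
    -- With no basis element below `D`, even `0` would be a common divisor and would divide `Q₁`.
    have hQD : weightedTotalDegree (weights k) Q < D := by
      by_contra! hle
      have hno : ∀ P ∈ Q :: L, ¬ weightedTotalDegree (weights k) P < D := by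
        intro P hP
        rcases List.mem_cons.mp hP with rfl | hP
        · exact hle.not_gt
        · exact (hle.trans (hsort.1 P hP)).not_gt
      have h0 := hGB.dvd_of_weightedTotalDegree_lt (h := 0)
        (fun P hP hlt => absurd hlt (hno P hP)) hQ₁ hQ₁D
      exact hQ₁0 (zero_dvd_iff.mp h0)
    refine exists_recoveryLoop_eq_some L Q hsort.2 ?_ fun h hQ hL => hfree h fun P hP hlt => ?_
    · by_contra! hno
      obtain ⟨h1, h2⟩ := hfree Q fun P hP hlt => by
        rcases List.mem_cons.mp hP with rfl | hP
        · exact dvd_rfl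
        · exact absurd hlt (hno P hP).not_gt
      obtain ⟨hQI, hQ0⟩ := hGB.1 Q List.mem_cons_self
      have hle := card_mul_le_weightedTotalDegree (m := m₁) hQ0 h1 h2
        (P := fun s => interpolationPoint α β s (R 0 s) (R 1 s)) hα
        (fun s => by simpa [requiredMultiplicity] using hQI s (R 0 s) (R 1 s))
        (w := weights k) rfl
      rw [Fintype.card_fin] at hle
      omega
    · rcases List.mem_cons.mp hP with rfl | hP
      · exact hQ
      · exact hL P hP hlt

/-- The Johnson radius is a natural number `t < n / 2` that satisfies the Johnson inequality. -/
theorem exists_binaryJohnsonRadius_eq {n k : ℕ} (hk : k ≤ n) (hd : 2 * designedDistance n k ≤ n) :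
    ∃ t : ℕ, binaryJohnsonRadius n (designedDistance n k) = t ∧ 2 * t < n ∧
      (n : ℝ) * (k - 1) < ((n : ℝ) - t) ^ 2 + t ^ 2 := by
  set d := designedDistance n k with hdef
  have hd1 : d = n - k + 1 := rfl
  have hn : (0 : ℝ) < n := by
    have : 0 < n := by omega
    exact_mod_cast this
  have hdn : (2 * d : ℝ) ≤ n := by exact_mod_cast hd
  have hdk : (d : ℝ) = n - k + 1 := by
    rw [hd1]
    push_cast [hk]
    ring
  have hd0 : (0 : ℝ) < d := by
    have : 0 < d := by omega
    exact_mod_cast this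
  have hrad : 0 ≤ 1 - 2 * (d : ℝ) / n := by
    rw [sub_nonneg, div_le_one hn]
    exact hdn
  have hsq := Real.sq_sqrt hrad
  have hs0 := Real.sqrt_nonneg (1 - 2 * (d : ℝ) / n)
  have hs1 : √(1 - 2 * (d : ℝ) / n) < 1 := by
    rw [Real.sqrt_lt' one_pos]
    have : 0 < 2 * (d : ℝ) / n := by positivity
    linarith
  have hlt := Int.ceil_lt_add_one (((n : ℝ) - n * √(1 - 2 * d / n)) / 2 - 1)
  have h0 : 0 ≤ binaryJohnsonRadius n d := by
    rw [binaryJohnsonRadius, ← Int.sub_one_lt_iff, zero_sub, Int.lt_ceil]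
    push_cast
    nlinarith
  obtain ⟨t, ht⟩ := Int.eq_ofNat_of_zero_le h0
  rw [binaryJohnsonRadius] at ht
  rw [ht] at hlt
  set σ := √(1 - 2 * (d : ℝ) / n)
  -- The `- 1` inside the ceiling makes `t < (n - n σ) / 2` strict.
  have hgap : n * σ < n - 2 * t := by
    push_cast at hlt
    linarith
  have hnσ : 0 ≤ n * σ := by positivity
  refine ⟨t, ht, ?_, ?_⟩
  · have : (2 * t : ℝ) < n := by linarith
    exact_mod_cast this
  · have h1 : (n * σ) ^ 2 = n ^ 2 - 2 * d * n := by
      rw [mul_pow, hsq]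
      field_simp
    have h2 : (n * σ) ^ 2 < (n - 2 * t) ^ 2 := by gcongr
    rw [h1, hdk] at h2
    nlinarith

/-- For large multiplicities of ratio close to `t / (n - t)` the monomials of weighted degree below
`m₁ (n - t) + m₂ t` outnumber the interpolation constraints. -/
theorem exists_count_lt {n t κ : ℕ} (ht : 2 * t < n)
    (hJ : (n : ℝ) * κ < ((n : ℝ) - t) ^ 2 + t ^ 2) :
    ∃ ε : ℝ, 0 < ε ∧ ∃ M : ℕ, ∀ m₁ m₂ : ℕ, M ≤ m₁ → m₂ < m₁ →
      |(m₂ : ℝ) / m₁ - t / (n - t)| < ε →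
      κ * (n * (m₁ * (m₁ + 1) + m₂ * (m₂ + 1))) < (m₁ * (n - t) + m₂ * t) ^ 2 := by
  have hnt : (0 : ℝ) < n - t := by
    have : (t : ℝ) < n := by exact_mod_cast (by omega : t < n)
    linarith
  set ρ : ℝ := t / (n - t) with hρ
  have hρt : ρ * (n - t) = t := div_mul_cancel₀ _ hnt.ne'
  -- The counting inequality divided by `m₁²`, at `z = (m₂ / m₁, 1 / m₁)`; the term `2 * z.2` bounds
  -- the linear part `(m₁ + m₂) / m₁²`.
  let g : ℝ × ℝ → ℝ := fun z =>
    (n - t + z.1 * t) ^ 2 - κ * n * (1 + z.1 ^ 2 + 2 * z.2)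
  have hg : Continuous g := by fun_prop
  have hg0 : 0 < g (ρ, 0) := by
    -- By Cauchy–Schwarz `(n - t + ρ t)² ≤ (1 + ρ²) ((n - t)² + t²)`, and this `ρ` is the case of
    -- equality.
    have h1 : g (ρ, 0) * (n - t) ^ 2 =
        (((n : ℝ) - t) ^ 2 + t ^ 2) * ((((n : ℝ) - t) ^ 2 + t ^ 2) - n * κ) := by
      simp only [g]
      generalize hv : (n : ℝ) - t = v at *
      rw [← hρt]
      ring
    have h2 : 0 < g (ρ, 0) * (n - t) ^ 2 := by
      rw [h1]
      have : 0 < ((n : ℝ) - t) ^ 2 + t ^ 2 := by positivity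
      exact mul_pos this (by linarith)
    exact pos_of_mul_pos_left h2 (by positivity)
  obtain ⟨ε, hε, hball⟩ := Metric.eventually_nhds_iff.mp
    (hg.continuousAt.eventually (lt_mem_nhds hg0))
  obtain ⟨M, hM⟩ := exists_nat_gt (1 / ε)
  refine ⟨ε, hε, M, fun m₁ m₂ hm₁ hm hr => ?_⟩
  have hm0 : (0 : ℝ) < m₁ := by exact_mod_cast (by omega : 0 < m₁)
  have hinv : 1 / (m₁ : ℝ) < ε := by
    rw [div_lt_comm₀ hm0 hε]
    exact hM.trans_le (by exact_mod_cast hm₁)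
  have hpos := @hball ((m₂ : ℝ) / m₁, 1 / m₁) (by
    rw [Prod.dist_eq, max_lt_iff, Real.dist_eq, Real.dist_eq]
    refine ⟨hr, ?_⟩
    rwa [sub_zero, abs_of_pos (one_div_pos.mpr hm0)])
  have hmul : 0 < g ((m₂ : ℝ) / m₁, 1 / m₁) * (m₁ : ℝ) ^ 2 := by positivity
  have heq : g ((m₂ : ℝ) / m₁, 1 / m₁) * (m₁ : ℝ) ^ 2 =
      (m₁ * (n - t) + m₂ * t) ^ 2 - κ * n * (m₁ ^ 2 + m₂ ^ 2 + 2 * m₁) := by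
    simp only [g]
    field_simp
  rw [heq] at hmul
  have hm' : (m₂ : ℝ) ≤ m₁ := by exact_mod_cast hm.le
  have hκn : (0 : ℝ) ≤ κ * n := by positivity
  have hfin : (κ : ℝ) * (n * (m₁ * (m₁ + 1) + m₂ * (m₂ + 1))) <
      (m₁ * (n - t) + m₂ * t) ^ 2 := by
    nlinarith [mul_le_mul_of_nonneg_left hm' hκn]
  have htn : t ≤ n := by omega
  rw [← Nat.cast_lt (α := ℝ)]
  push_cast [htn]
  exact hfin

end InterleavedAlternant

theorem mainTheorem3 (n k : ℕ) (hk : k ≤ n) (hd : 2 * designedDistance n k ≤ n) :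
    ∃ ε : ℝ, 0 < ε ∧ ∃ M : ℕ, ∀ m₁ m₂ : ℕ, M ≤ m₁ → M ≤ m₂ → m₂ < m₁ →
      |(m₂ : ℝ) / m₁ - (binaryJohnsonRadius n (designedDistance n k) : ℝ) /
        (n - binaryJohnsonRadius n (designedDistance n k))| < ε →
      ∀ (F : Type*) [Field F] [Finite F] [Algebra (ZMod 2) F] (α β : Fin n → F),
        Function.Injective α → (∀ s, β s ≠ 0) →
        ∀ 𝒢 : Matrix (Fin 2) (Fin n) (ZMod 2) → List (MvPolynomial (Fin 3) F),
          (∀ R, IsInterpolationOutput α β k R m₁ m₂ (𝒢 R)) →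
          ∀ C ∈ interleavedCode α β k,
            (∀ E : Matrix (Fin 2) (Fin n) (ZMod 2), ∃ τ : ℝ,
              achievedRadius n k m₁ m₂ (𝒢 (C + E)) = some τ ∧
              (binaryJohnsonRadius n (designedDistance n k) : ℝ) < τ) ∧
            (∀ law : PMF (Matrix (Fin 2) (Fin n) (ZMod 2)),
              law.toOuterMeasure {E | achievedRadius n k m₁ m₂ (𝒢 (C + E)) = none} = 0) := by
  obtain ⟨t, ht, htn, hJ⟩ := exists_binaryJohnsonRadius_eq hk hd
  have hk1 : 1 < k := by
    unfold designedDistance at hd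
    omega
  obtain ⟨ε, hε, M, hM⟩ := exists_count_lt (κ := k - 1) htn (by
    rwa [Nat.cast_sub hk1.le, Nat.cast_one])
  refine ⟨ε, hε, M, fun m₁ m₂ hm₁ _ hm hr F _ _ _ α β hα _ 𝒢 h𝒢 C _ => ?_⟩
  rw [ht, Int.cast_natCast] at hr ⊢
  have key : ∀ E : Matrix (Fin 2) (Fin n) (ZMod 2), ∃ τ : ℝ,
      achievedRadius n k m₁ m₂ (𝒢 (C + E)) = some τ ∧ (t : ℝ) < τ := by
    intro E
    have hDn : m₁ * (n - t) + m₂ * t ≤ n * m₁ := by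
      calc m₁ * (n - t) + m₂ * t ≤ m₁ * (n - t) + m₁ * t := by gcongr
        _ = n * m₁ := by rw [← mul_add, Nat.sub_add_cancel (by omega), mul_comm]
    obtain ⟨Δ, hΔ, hrec⟩ := exists_recoveryDegree_eq_some hk1 hα hm.le hDn
      (hM m₁ m₂ hm₁ hm hr) (h𝒢 (C + E))
    refine ⟨((n : ℝ) - Δ / m₁) / (1 - (m₂ : ℝ) / m₁), by rw [achievedRadius, hrec]; rfl, ?_⟩
    have hm0 : (0 : ℝ) < m₁ := by exact_mod_cast (by omega : 0 < m₁)
    have hm' : (m₂ : ℝ) < m₁ := by exact_mod_cast hm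
    have hΔ' : (Δ : ℝ) < m₁ * (n - t) + m₂ * t := by
      have htn' : t ≤ n := by omega
      have := Nat.cast_lt (α := ℝ).mpr hΔ
      push_cast [htn'] at this
      exact this
    -- After clearing denominators the claim is exactly `hΔ'`.
    rw [lt_div_iff₀ (by rw [sub_pos, div_lt_one hm0]; exact hm'), ← mul_lt_mul_iff_left₀ hm0]
    field_simp
    linarith
  refine ⟨key, fun law => ?_⟩
  have hempty : {E | achievedRadius n k m₁ m₂ (𝒢 (C + E)) = none} = ∅ := by
    refine Set.eq_empty_of_forall_notMem fun E hE => ?_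
    obtain ⟨τ, hτ, -⟩ := key E
    rw [Set.mem_ofPred_eq, hτ] at hE
    exact Option.some_ne_none τ hE
  rw [hempty, MeasureTheory.measure_empty]
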